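/- Let $M$ be a loopless matroid of rank $n+1$ on a finite set $E$. For $S\subseteq E$ let $v_S\in\mathbb R^E/\mathbb R\mathbf 1$ be the class of the indicator vector of $S$, where $\mathbf 1=(1,\dots,1)$. A chain of flats of length $l$ is a sequence $\mathcal F=(E\supsetneq F_1\supsetneq\dots\supsetneq F_l\supsetneq\emptyset)$ of flats of $M$; its cone $\sigma_{\mathcal F}$ is the set of nonnegative linear combinations of $v_{F_1},\dots,v_{F_l}$. These cones form the projective matroid fan $\Sigma_M\subset\mathbb R^E/\mathbb R\mathbf 1$. The framing group $\mathbf F_p(\Sigma_M)\subset\bigwedge^p(\mathbb R^E/\mathbb R\mathbf 1)$ is the linear span of all wedges $w_1\wedge\dots\wedge w_p$ of $p$ vectors contained in a common cone $\sigma_{\mathcal F}$. Let $\mathcal C^{\le p}_l$ be the set of chains of flats of length $l$ all of whose members $F_1,\dots,F_l$ have rank at most $p$, and let $\mathbb R\,\mathcal C^{\le p}_l$ be the real vector space with basis $(e_{\mathcal F})_{\mathcal F\in\mathcal C^{\le p}_l}$. Let $\partial\colon\mathbb R\,\mathcal C^{\le p}_l\to\mathbb R\,\mathcal C^{\le p}_{l+1}$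 be the simplicial coboundary map $\partial e_{\mathcal F}=\sum_{\mathcal G}(-1)^{k(\mathcal G)}e_{\mathcal G}$, where the sum is over the chains $\mathcal G\in\mathcal C^{\le p}_{l+1}$ that refine $\mathcal F$ and $k(\mathcal G)\in\{1,\dots,l+1\}$ is the index of the flat $G_{k(\mathcal G)}$ of $\mathcal G$ that is not a member of $\mathcal F$. Let $V\colon\mathbb R\,\mathcal C^{\le p}_p\to\mathbf F_p(\Sigma_M)$ be the linear map with $V(e_{\mathcal F})=v_{F_1}\wedge\dots\wedge v_{F_p}$. Then for every $p\in\{0,\dots,n\}$ the sequence $$0\to\mathbb R\,\mathcal C^{\le p}_0\xrightarrow{\ \partial\ }\cdots\xrightarrow{\ \partial\ }\mathbb R\,\mathcal C^{\le p}_p\xrightarrow{\ V\ }\mathbf F_p(\Sigma_M)\to0$$ is exact. -/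

import Mathlib

noncomputable section

namespace MatroidFan

variable {α : Type*}

/-- The tuple `F 0 ⊋ F 1 ⊋ ⋯ ⊋ F (l - 1)` is a chain of flats of `M` of length `l`: all its members
are flats other than `∅` and the ground set. (The mathematical index of `F i` is `i + 1`.) -/
structure IsFlatChain (M : Matroid α) {l : ℕ} (F : Fin l → Set α) : Prop where
  isFlat : ∀ i, M.IsFlat (F i)
  strictAnti : StrictAnti F
  nonempty : ∀ i, (F i).Nonempty
  ne_ground : ∀ i, F i ≠ M.E

/-- The set of chains of flats of `M` of length `l` that use only flats of rank at most `p`. -/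
def Chain (M : Matroid α) (p l : ℕ) : Type _ :=
  {F : Fin l → Set α // IsFlatChain M F ∧ ∀ i, M.eRk (F i) ≤ p}

/-- The ambient space `ℝ^E / ℝ𝟏` of the projective matroid fan. -/
abbrev Ambient (M : Matroid α) : Type _ :=
  (M.E → ℝ) ⧸ Submodule.span ℝ {(1 : M.E → ℝ)}

open Classical in
/-- The indicator vector of `S`, as an element of `ℝ^E / ℝ𝟏`. -/
def vec (M : Matroid α) (S : Set α) : Ambient M :=
  Submodule.Quotient.mk fun e : M.E => if (e : α) ∈ S then 1 else 0

/-- The cone in `ℝ^E / ℝ𝟏` generated by the indicator vectors of the members of `F`. The cones of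
the projective matroid fan of `M` are the cones of the chains of flats of `M`. -/
def cone (M : Matroid α) {l : ℕ} (F : Fin l → Set α) : PointedCone ℝ (Ambient M) :=
  PointedCone.hull ℝ (Set.range fun i => vec M (F i))

/-- The framing group `F_p` of the projective matroid fan of `M`: the subspace of `⋀^p (ℝ^E / ℝ𝟏)`
spanned by the wedges of `p` vectors that lie in a common cone of the fan. -/
def framingGroup (M : Matroid α) (p : ℕ) : Submodule ℝ (⋀[ℝ]^p (Ambient M)) :=
  Submodule.span ℝ {x | ∃ (l : ℕ) (F : Fin l → Set α), IsFlatChain M F ∧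
    ∃ w : Fin p → Ambient M, (∀ i, w i ∈ cone M F) ∧ exteriorPower.ιMulti ℝ p w = x}

/-- The chain obtained from `G` by omitting its `k`-th member. -/
def Chain.face {M : Matroid α} {p l : ℕ} (G : Chain M p (l + 1)) (k : Fin (l + 1)) :
    Chain M p l :=
  ⟨fun i => G.1 (k.succAbove i),
    ⟨fun _ => G.2.1.isFlat _, G.2.1.strictAnti.comp_strictMono (Fin.strictMono_succAbove k),
      fun _ => G.2.1.nonempty _, fun _ => G.2.1.ne_ground _⟩, fun _ => G.2.2 _⟩

instance (M : Matroid α) [M.Finite] (p l : ℕ) : Finite (Chain M p l) := by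
  have : Finite (𝒫 M.E) := M.ground_finite.finite_subsets
  refine Finite.of_injective
    (fun (F : Chain M p l) (i : Fin l) => (⟨F.1 i, (F.2.1.isFlat i).subset_ground⟩ : 𝒫 M.E)) ?_
  intro F G h
  refine Subtype.ext (funext fun i => ?_)
  exact congrArg Subtype.val (congrFun h i)

instance (M : Matroid α) [M.Finite] (p l : ℕ) : Fintype (Chain M p l) := Fintype.ofFinite _

open Classical in
/-- The incidence number of `F` and `G`: it is `(-1)^k` if `F` arises from `G` by omitting the
`k`-th member, counted from `k = 1` (at most one `k` has this property), and `0` otherwise. -/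
def incidence {M : Matroid α} {p l : ℕ} (F : Chain M p l) (G : Chain M p (l + 1)) : ℝ :=
  ∑ k : Fin (l + 1), if G.face k = F then (-1) ^ ((k : ℕ) + 1) else 0

/-- The simplicial coboundary map between the vector spaces with bases `Chain M p l` and
`Chain M p (l + 1)`; it maps the basis vector of `F` to the sum over all `G` of the basis vector of
`G` times the incidence number of `F` and `G`. -/
def coboundary (M : Matroid α) [M.Finite] (p l : ℕ) :
    (Chain M p l →₀ ℝ) →ₗ[ℝ] (Chain M p (l + 1) →₀ ℝ) :=
  Finsupp.linearCombination ℝ fun F =>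
    ∑ G : Chain M p (l + 1), Finsupp.single G (incidence F G)

/-- The volume element `v_{F_1} ∧ ⋯ ∧ v_{F_l}` of a chain of length `l`. -/
def volumeElement (M : Matroid α) (p l : ℕ) (F : Chain M p l) : framingGroup M l :=
  ⟨exteriorPower.ιMulti ℝ l fun i => vec M (F.1 i),
    Submodule.subset_span ⟨l, F.1, F.2.1, _,
      fun i => Submodule.subset_span (Set.mem_range_self i), rfl⟩⟩

/-- The linear map to the framing group `F_l` that sends the basis vector of a chain of length `l`
(with flats of rank at most `p`) to its volume element. -/
def volumeMap (M : Matroid α) (p l : ℕ) : (Chain M p l →₀ ℝ) →ₗ[ℝ] framingGroup M l :=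
  Finsupp.linearCombination ℝ (volumeElement M p l)

end MatroidFan

end

/-! The proof is an induction on p, for all flats G of rank greater than p at once
(`isCob_of_cocycle`); the theorem is the case G = E. Below G, the complex is formed by the chains of
nonempty flats of rank at most p properly inside G, and V is replaced by c ↦ ∑ c_K v_G ∧ v_K. This
wedge is tested by minors (`vol`): the rows are indicator vectors, with that of G first, and the
columns are elements of G. For G = E the first row 𝟏 accounts for the quotient by ℝ𝟏.

All linear relations come from one fact: the flats covering H inside T partition T \ H
(`sum_coverFlats`). So in a wedge that also contains v_H, or if H = ∅, v_T equals the sum of the v_F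
over these covers F. This yields V ∘ ∂ = 0 (`sum_delta_smul_map_ind`) and shows that chains of low
rank span (`map_ind_mem_span`).

For the step from p to p + 1, let c be a cocycle of degree at most p. Its restriction to flats of
rank at most p is some ∂b by induction. In degree p this needs vanishing volume: any p + 1 columns
lie in a flat F of rank p + 1, such a minor sees only chains inside F, and there the cocycle
condition makes c a coboundary. For every F of rank p + 1 the cochain K ↦ c(F, K) + b(K) is then a
cocycle below F, hence some ∂β_F. Taking -β_F on chains headed by F and b elsewhere gives a
primitive of c (`isCob_of_forall_isFlat`). In degree p + 1, where c has zero volume, the restriction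
to rank at most p is void, and b comes from contracting ∑ c_L v_L with an element of G
(`exists_sum_vol_eq`). -/

noncomputable section

namespace MatroidFan

open Matroid

variable {α : Type*} {M : Matroid α}

/-! ### Ranks and flats -/

/-- The rank of a set in a matroid, as a natural number. -/
def rk (M : Matroid α) (S : Set α) : ℕ := (M.eRk S).toNat

lemma coe_rk [M.Finite] (S : Set α) : (rk M S : ℕ∞) = M.eRk S :=
  ENat.natCast_toNat (eRk_ne_top_iff.2 (M.isRkFinite_set S))

lemma rk_mono [M.Finite] {S T : Set α} (h : S ⊆ T) : rk M S ≤ rk M T := by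
  have := M.eRk_mono h
  rw [← coe_rk, ← coe_rk] at this
  exact_mod_cast this

lemma rk_closure (S : Set α) : rk M (M.closure S) = rk M S := by
  simp [rk]

@[simp] lemma rk_empty : rk M ∅ = 0 := by
  simp [rk]

lemma rk_insert [M.Finite] {S : Set α} {e : α} (hS : M.IsFlat S) (he : e ∈ M.E) (heS : e ∉ S) :
    rk M (insert e S) = rk M S + 1 := by
  have := M.eRk_insert_eq_add_one (e := e) (X := S) ⟨he, by rwa [hS.closure]⟩
  rw [← coe_rk, ← coe_rk] at this
  exact_mod_cast this

lemma rk_lt_rk [M.Finite] {S T : Set α} (hS : M.IsFlat S) (hT : M.IsFlat T) (h : S ⊂ T) :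
    rk M S < rk M T := by
  obtain ⟨e, heT, heS⟩ := Set.exists_of_ssubset h
  have h1 := rk_insert hS (hT.subset_ground heT) heS
  have h2 := rk_mono (M := M) (Set.insert_subset heT h.subset)
  omega

lemma eq_of_subset_of_rk_le [M.Finite] {S T : Set α} (hS : M.IsFlat S) (hT : M.IsFlat T)
    (h : S ⊆ T) (hr : rk M T ≤ rk M S) : S = T := by
  by_contra hne
  have := rk_lt_rk hS hT (h.ssubset_of_ne hne)
  omega

lemma isFlat_empty [M.Loopless] : M.IsFlat ∅ := by
  rw [isFlat_iff_closure_eq]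
  exact M.loops_eq_empty

lemma rk_pos [M.Finite] [M.Loopless] {S : Set α} (hS : M.IsFlat S) (h : S.Nonempty) :
    0 < rk M S := by
  have := rk_lt_rk isFlat_empty hS h.empty_ssubset
  omega

lemma isFlat_inter {S T : Set α} (hS : M.IsFlat S) (hT : M.IsFlat T) : M.IsFlat (S ∩ T) := by
  rw [Set.inter_eq_iInter]
  exact Matroid.IsFlat.iInter fun b => by cases b <;> assumption

lemma closure_subset_of_isFlat {S T : Set α} (hT : M.IsFlat T) (h : S ⊆ T) : M.closure S ⊆ T := by
  have := M.closure_subset_closure h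
  rwa [hT.closure] at this

/-- A set can be enlarged to a flat of any prescribed rank. -/
lemma exists_isFlat_rk_eq [M.Finite] {G : Set α} (hG : M.IsFlat G) {q : ℕ} (hq : q ≤ rk M G) :
    ∀ {X : Set α}, X ⊆ G → rk M X ≤ q → ∃ F, M.IsFlat F ∧ X ⊆ F ∧ F ⊆ G ∧ rk M F = q := by
  suffices ∀ d, ∀ {X : Set α}, X ⊆ G → rk M X + d = q →
      ∃ F, M.IsFlat F ∧ X ⊆ F ∧ F ⊆ G ∧ rk M F = q from
    fun {X} hX hr => this (q - rk M X) hX (by omega)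
  intro d
  induction d with
  | zero =>
    intro X hX hr
    exact ⟨M.closure X, M.isFlat_closure X, M.subset_closure X (hX.trans hG.subset_ground),
      closure_subset_of_isFlat hG hX, by rw [rk_closure]; omega⟩
  | succ d ih =>
    intro X hX hr
    have hne : ¬ G ⊆ M.closure X := fun h => by
      have := rk_mono (M := M) h
      rw [rk_closure] at this
      omega
    obtain ⟨e, heG, heX⟩ := Set.not_subset.1 hne
    have h1 := rk_insert (M.isFlat_closure X) (hG.subset_ground heG) heX
    rw [rk_closure] at h1
    obtain ⟨F, hF, hXF, h⟩ := ih (X := insert e (M.closure X))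
      (Set.insert_subset heG (closure_subset_of_isFlat hG hX)) (by omega)
    exact ⟨F, hF, ((M.subset_closure X (hX.trans hG.subset_ground)).trans
      (Set.subset_insert _ _)).trans hXF, h⟩

lemma finite_isFlat [M.Finite] : {F | M.IsFlat F}.Finite :=
  M.ground_finite.finite_subsets.subset fun _ hF => hF.subset_ground

/-- The flats between `H` and `G` whose rank exceeds that of `H` by one. -/
def coverFlats (M : Matroid α) [M.Finite] (H G : Set α) : Finset (Set α) :=
  ((finite_isFlat (M := M)).subset (t := {F | M.IsFlat F ∧ H ⊆ F ∧ F ⊆ G ∧ rk M F = rk M H + 1})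
    fun _ h => h.1).toFinset

lemma mem_coverFlats [M.Finite] {H G F : Set α} :
    F ∈ coverFlats M H G ↔ M.IsFlat F ∧ H ⊆ F ∧ F ⊆ G ∧ rk M F = rk M H + 1 := by
  simp [coverFlats]

/-! ### Indicator vectors and the covering partition -/

/-- The indicator function of a set. -/
def ind (S : Set α) : α → ℝ := S.indicator 1

lemma ind_of_mem {S : Set α} {e : α} (h : e ∈ S) : ind S e = 1 := by simp [ind, h]

lemma ind_of_notMem {S : Set α} {e : α} (h : e ∉ S) : ind S e = 0 := by simp [ind, h]

@[simp] lemma ind_empty : ind (∅ : Set α) = 0 := by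
  ext; simp [ind]

lemma ind_inter_of_mem {S F : Set α} {e : α} (h : e ∈ F) : ind (S ∩ F) e = ind S e := by
  by_cases hS : e ∈ S <;> simp [ind, h, hS]

/-- The flats covering `H` inside `G` partition `G \ H`. -/
lemma sum_coverFlats [M.Finite] {H G : Set α} (hH : M.IsFlat H) (hG : M.IsFlat G) (h : H ⊆ G) :
    ∑ F ∈ coverFlats M H G, (ind F - ind H) = ind G - ind H := by
  ext e
  simp only [Finset.sum_apply, Pi.sub_apply]
  by_cases heH : e ∈ H
  · rw [Finset.sum_eq_zero, ind_of_mem heH, ind_of_mem (h heH), sub_self]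
    intro F hF
    rw [ind_of_mem heH, ind_of_mem ((mem_coverFlats.1 hF).2.1 heH), sub_self]
  by_cases heG : e ∈ G
  · have hr := rk_insert hH (hG.subset_ground heG) heH
    have hsub : insert e H ⊆ M.E := Set.insert_subset (hG.subset_ground heG) hH.subset_ground
    rw [Finset.sum_eq_single (M.closure (insert e H))]
    · rw [ind_of_mem heG, ind_of_mem]
      exact M.subset_closure _ hsub (Set.mem_insert _ _)
    · intro F hF hne
      obtain ⟨hF, hHF, hFG, hrF⟩ := mem_coverFlats.1 hF
      rw [ind_of_notMem heH, ind_of_notMem, sub_self]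
      intro heF
      refine hne (eq_of_subset_of_rk_le (M.isFlat_closure _) hF
        (closure_subset_of_isFlat hF (Set.insert_subset heF hHF)) ?_).symm
      rw [rk_closure, hr, hrF]
    · intro hne
      refine absurd (mem_coverFlats.2 ⟨M.isFlat_closure _, ?_, ?_, ?_⟩) hne
      · exact (Set.subset_insert _ _).trans (M.subset_closure _ hsub)
      · exact closure_subset_of_isFlat hG (Set.insert_subset heG h)
      · rw [rk_closure, hr]
  · rw [Finset.sum_eq_zero, ind_of_notMem heH, ind_of_notMem heG, sub_self]
    intro F hF
    rw [ind_of_notMem heH, ind_of_notMem fun h => heG ((mem_coverFlats.1 hF).2.2.1 h), sub_self]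

/-! ### Chains below a flat -/

/-- A chain of length `l` of nonempty flats properly contained in `G`, of rank at most `p`. -/
structure IsChainBelow (M : Matroid α) (G : Set α) (p : ℕ) {l : ℕ} (K : Fin l → Set α) : Prop where
  isFlat : ∀ i, M.IsFlat (K i)
  strictAnti : StrictAnti K
  nonempty : ∀ i, (K i).Nonempty
  ssubset : ∀ i, K i ⊂ G
  rk_le : ∀ i, rk M (K i) ≤ p

/-- The finite set of chains of nonempty flats properly contained in `G`, of rank at most `p`. -/
def chainsBelow (M : Matroid α) [M.Finite] (G : Set α) (p l : ℕ) : Finset (Fin l → Set α) :=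
  ((Set.Finite.pi' fun _ => finite_isFlat (M := M)).subset
    (t := {K : Fin l → Set α | IsChainBelow M G p K}) fun _ h => h.isFlat).toFinset

lemma mem_chainsBelow [M.Finite] {G : Set α} {p l : ℕ} {K : Fin l → Set α} :
    K ∈ chainsBelow M G p l ↔ IsChainBelow M G p K := by
  simp [chainsBelow]

/-- Count upwards from the last member: it has positive rank, and every step up the chain adds at
least one. -/
lemma le_rk_of_strictAnti [M.Finite] [M.Loopless] {l : ℕ} {K : Fin l → Set α}
    (hK : ∀ i, M.IsFlat (K i)) (ha : StrictAnti K) (hne : ∀ i, (K i).Nonempty) (i : Fin l) :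
    l ≤ rk M (K i) + i := by
  suffices ∀ d, ∀ i : Fin l, (i : ℕ) + d < l → d + 1 ≤ rk M (K i) by
    have := this (l - 1 - i) i (by omega)
    omega
  intro d
  induction d with
  | zero => exact fun i _ => rk_pos (hK i) (hne i)
  | succ d ih =>
    intro i hi
    have h1 := ih ⟨i + 1, by omega⟩ (by simp only; omega)
    have h2 := rk_lt_rk (hK _) (hK _) (ha (show i < ⟨i + 1, by omega⟩ from Nat.lt_succ_self _))
    omega

namespace IsChainBelow

variable {G : Set α} {p l : ℕ}

lemma rk_add [M.Finite] {K : Fin l → Set α} (h : IsChainBelow M G p K) (i : Fin l) :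
    rk M (K i) + i ≤ p := by
  obtain ⟨i, hi⟩ := i
  induction i with
  | zero => exact h.rk_le _
  | succ i ih =>
    have h1 := ih (by omega)
    have h2 := rk_lt_rk (h.isFlat _) (h.isFlat _)
      (h.strictAnti (show (⟨i, by omega⟩ : Fin l) < ⟨i + 1, hi⟩ from Nat.lt_succ_self _))
    simp only at *
    omega

/-- The counts from above and from below meet, so a chain of maximal length has exactly one member
of each rank from 1 to `p`. -/
lemma rk_eq [M.Finite] [M.Loopless] {K : Fin p → Set α} (h : IsChainBelow M G p K) (i : Fin p) :
    rk M (K i) + i = p :=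
  le_antisymm (h.rk_add i) (le_rk_of_strictAnti h.isFlat h.strictAnti h.nonempty i)

lemma mono {q : ℕ} {K : Fin l → Set α} (h : IsChainBelow M G p K) (hpq : p ≤ q) :
    IsChainBelow M G q K :=
  ⟨h.isFlat, h.strictAnti, h.nonempty, h.ssubset, fun i => (h.rk_le i).trans hpq⟩

lemma comp_succAbove {K : Fin (l + 1) → Set α} (h : IsChainBelow M G p K) (k : Fin (l + 1)) :
    IsChainBelow M G p (K ∘ k.succAbove) :=
  ⟨fun _ => h.isFlat _, h.strictAnti.comp_strictMono (Fin.strictMono_succAbove k),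
    fun _ => h.nonempty _, fun _ => h.ssubset _, fun _ => h.rk_le _⟩

lemma of_elim (K : Fin 0 → Set α) : IsChainBelow M G p K :=
  ⟨fun i => i.elim0, fun i => i.elim0, fun i => i.elim0, fun i => i.elim0, fun i => i.elim0⟩

lemma cons {F : Set α} {K : Fin l → Set α} (hK : IsChainBelow M F p K) (hF : M.IsFlat F)
    (hne : F.Nonempty) (hFG : F ⊂ G) {q : ℕ} (hp : p ≤ q) (hq : rk M F ≤ q) :
    IsChainBelow M G q (Matrix.vecCons F K) where
  isFlat := Fin.cases hF hK.isFlat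
  strictAnti := by
    intro i j hij
    cases j using Fin.cases with
    | zero => exact absurd hij (Fin.not_lt_zero _)
    | succ j =>
      cases i using Fin.cases with
      | zero => exact hK.ssubset j
      | succ i => exact hK.strictAnti (Fin.succ_lt_succ_iff.1 hij)
  nonempty := Fin.cases hne hK.nonempty
  ssubset := Fin.cases hFG fun i => (hK.ssubset i).trans hFG
  rk_le := Fin.cases hq fun i => (hK.rk_le i).trans hp

lemma tail [M.Finite] {F : Set α} {K : Fin l → Set α}
    (h : IsChainBelow M G (p + 1) (Matrix.vecCons F K)) (hF : rk M F ≤ p + 1) :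
    IsChainBelow M F p K where
  isFlat i := h.isFlat i.succ
  strictAnti i j hij := h.strictAnti (Fin.succ_lt_succ_iff.2 hij)
  nonempty i := h.nonempty i.succ
  ssubset i := h.strictAnti (Fin.succ_pos i)
  rk_le i := by
    have := rk_lt_rk (h.isFlat i.succ) (h.isFlat 0) (h.strictAnti (Fin.succ_pos i))
    simp only [Matrix.cons_val_zero, Matrix.cons_val_succ] at this
    omega

lemma of_head_le [M.Finite] {K : Fin (l + 1) → Set α} (h : IsChainBelow M G (p + 1) K)
    (h0 : rk M (K 0) ≤ p) : IsChainBelow M G p K where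
  isFlat := h.isFlat
  strictAnti := h.strictAnti
  nonempty := h.nonempty
  ssubset := h.ssubset
  rk_le i := (rk_mono (h.strictAnti.antitone (Fin.zero_le i))).trans h0

end IsChainBelow

namespace IsChainBelow

variable {G : Set α} {p l : ℕ}

/-- Here `∅`, and `G` in `exists_prev`, serve as neighbours of the end members, so the ends of a
chain need no separate argument later. -/
lemma exists_next [M.Loopless] {K : Fin l → Set α} (h : IsChainBelow M G p K) (i : Fin l) :
    ∃ H, M.IsFlat H ∧ H ⊂ K i ∧ (∀ j, i < j → K j ⊆ H) ∧
      (H = ∅ ∧ (i : ℕ) + 1 = l ∨ ∃ j : Fin l, (j : ℕ) = i + 1 ∧ H = K j) := by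
  by_cases hi : (i : ℕ) + 1 < l
  · exact ⟨K ⟨i + 1, hi⟩, h.isFlat _, h.strictAnti (Nat.lt_succ_self _),
      fun j hj => h.strictAnti.antitone (Nat.succ_le_of_lt hj), Or.inr ⟨_, rfl, rfl⟩⟩
  · exact ⟨∅, isFlat_empty, (h.nonempty i).empty_ssubset, fun j hj => by omega,
      Or.inl ⟨rfl, by omega⟩⟩

lemma exists_prev {K : Fin l → Set α} (hG : M.IsFlat G) (h : IsChainBelow M G p K) (i : Fin l) :
    ∃ H, M.IsFlat H ∧ K i ⊂ H ∧ H ⊆ G ∧ (∀ j, j < i → H ⊆ K j) ∧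
      (H = G ∧ (i : ℕ) = 0 ∨ ∃ j : Fin l, (j : ℕ) + 1 = i ∧ H = K j) := by
  obtain ⟨i, hi⟩ := i
  cases i with
  | zero =>
    exact ⟨G, hG, h.ssubset _, subset_rfl, fun j hj => absurd hj (by simp [Fin.lt_def]),
      Or.inl ⟨rfl, rfl⟩⟩
  | succ i =>
    exact ⟨K ⟨i, by omega⟩, h.isFlat _, h.strictAnti (Nat.lt_succ_self _), (h.ssubset _).subset,
      fun j hj => h.strictAnti.antitone (Nat.le_of_lt_succ hj), Or.inr ⟨_, rfl, rfl⟩⟩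

lemma update {K : Fin l → Set α} (h : IsChainBelow M G p K) {i : Fin l} {F : Set α}
    (hF : M.IsFlat F) (hne : F.Nonempty) (hFG : F ⊂ G) (hp : rk M F ≤ p)
    (hlt : ∀ j, i < j → K j ⊂ F) (hgt : ∀ j, j < i → F ⊂ K j) :
    IsChainBelow M G p (Function.update K i F) where
  isFlat j := by
    rcases eq_or_ne j i with rfl | hj
    · simpa
    · simpa [hj] using h.isFlat j
  strictAnti j k hjk := by
    rcases eq_or_ne j i with rfl | hj
    · rw [Function.update_self, Function.update_of_ne hjk.ne']
      exact hlt k hjk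
    · rw [Function.update_of_ne hj]
      rcases eq_or_ne k i with rfl | hk
      · rw [Function.update_self]
        exact hgt j hjk
      · rw [Function.update_of_ne hk]
        exact h.strictAnti hjk
  nonempty j := by
    rcases eq_or_ne j i with rfl | hj
    · simpa
    · simpa [hj] using h.nonempty j
  ssubset j := by
    rcases eq_or_ne j i with rfl | hj
    · simpa
    · simpa [hj] using h.ssubset j
  rk_le j := by
    rcases eq_or_ne j i with rfl | hj
    · simpa
    · simpa [hj] using h.rk_le j

end IsChainBelow

/-! ### Relations between wedges of chains -/

section Alternating

variable {N : Type*} [AddCommGroup N] [Module ℝ N]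

/-- Replacing an indicator vector in an alternating form by the sum over the covers of a flat on
which the form vanishes. -/
lemma map_update_ind [M.Finite] {l : ℕ} (φ : (α → ℝ) [⋀^Fin l]→ₗ[ℝ] N) (v : Fin l → α → ℝ)
    (i : Fin l) {H G : Set α} (hH : M.IsFlat H) (hG : M.IsFlat G) (hHG : H ⊆ G)
    (h0 : φ (Function.update v i (ind H)) = 0) :
    ∑ F ∈ coverFlats M H G, φ (Function.update v i (ind F)) = φ (Function.update v i (ind G)) := by
  have h := congrArg (φ.toMultilinearMap.toLinearMap v i) (sum_coverFlats hH hG hHG)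
  simp only [map_sum, map_sub] at h
  simpa [h0] using h

lemma ind_comp_update {l : ℕ} (K : Fin l → Set α) (i : Fin l) (F : Set α) :
    (fun j => ind (Function.update K i F j)) =
      Function.update (fun j => ind (K j)) i (ind F) := by
  ext j : 1
  rcases eq_or_ne j i with rfl | hj
  · simp
  · simp [hj]

lemma map_update_ind_of_mem {l : ℕ} (φ : (α → ℝ) [⋀^Fin l]→ₗ[ℝ] N) (K : Fin l → Set α)
    {i j : Fin l} (hij : i ≠ j) :
    φ (Function.update (fun k => ind (K k)) i (ind (K j))) = 0 :=
  φ.map_eq_zero_of_eq _ (by simp [hij.symm]) hij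

lemma map_update_ind_empty {l : ℕ} (φ : (α → ℝ) [⋀^Fin l]→ₗ[ℝ] N) (v : Fin l → α → ℝ)
    (i : Fin l) : φ (Function.update v i (ind ∅)) = 0 := by
  rw [ind_empty]
  exact φ.map_update_zero v i

/-- The wedge of a chain is a combination of the wedges of the chains using only flats of low
rank. -/
lemma map_ind_mem_span [M.Finite] [M.Loopless] {G : Set α} {p q : ℕ}
    (φ : (α → ℝ) [⋀^Fin q]→ₗ[ℝ] N) {K : Fin q → Set α} (hK : IsChainBelow M G p K) :
    φ (fun i => ind (K i)) ∈ Submodule.span ℝ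
      ((fun L : Fin q → Set α => φ fun i => ind (L i)) '' (chainsBelow M G q q : Set _)) := by
  -- The members from index `d` on already have their least possible rank `q - j`; `d` descends from
  -- `q`, where this says nothing, to 0.
  suffices ∀ d : ℕ, ∀ {K : Fin q → Set α}, IsChainBelow M G p K →
      (∀ j : Fin q, d ≤ j → rk M (K j) + j = q) →
      φ (fun i => ind (K i)) ∈ Submodule.span ℝ
        ((fun L : Fin q → Set α => φ fun i => ind (L i)) '' (chainsBelow M G q q : Set _)) from
    this q hK fun j hj => by omega
  intro d
  induction d with
  | zero =>
    intro K hK h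
    refine Submodule.subset_span ⟨K, ?_, rfl⟩
    refine mem_chainsBelow.2 ⟨hK.isFlat, hK.strictAnti, hK.nonempty, hK.ssubset, fun i => ?_⟩
    have := h i (Nat.zero_le _)
    omega
  | succ d ih =>
    intro K hK h
    by_cases hd : d < q
    swap
    · exact ih hK fun j hj => by omega
    obtain ⟨i, hi⟩ : ∃ i : Fin q, (i : ℕ) = d := ⟨⟨d, hd⟩, rfl⟩
    obtain ⟨H, hH, hHK, hHlt, hHeq⟩ := hK.exists_next i
    have hrH : rk M H + i + 1 = q := by
      rcases hHeq with ⟨rfl, h1⟩ | ⟨j, hj, rfl⟩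
      · simpa using h1
      · have := h j (by omega)
        omega
    have h0 : φ (Function.update (fun k => ind (K k)) i (ind H)) = 0 := by
      rcases hHeq with ⟨rfl, h1⟩ | ⟨j, hj, rfl⟩
      · exact map_update_ind_empty φ _ _
      · exact map_update_ind_of_mem φ K (Fin.ne_of_val_ne (by omega))
    -- Replace `K i` by the covers of its lower neighbour `H`: they have the desired rank `q - i`
    -- and still fit into the chain.
    have hsum := map_update_ind φ _ i hH (hK.isFlat i) hHK.subset h0
    rw [Function.update_eq_self] at hsum
    rw [← hsum]
    refine Submodule.sum_mem _ fun F hF => ?_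
    obtain ⟨hF, hHF, hFK, hrF⟩ := mem_coverFlats.1 hF
    have hHF' : H ⊂ F := hHF.ssubset_of_ne fun h => by subst h; omega
    rw [← ind_comp_update]
    refine ih (hK.update hF ?_ (hFK.trans_ssubset (hK.ssubset i))
      ((rk_mono hFK).trans (hK.rk_le i))
      (fun j hj => (hHlt j hj).trans_ssubset hHF')
      (fun j hj => hFK.trans_ssubset (hK.strictAnti hj))) ?_
    · exact Set.nonempty_of_ssubset' hHF'
    · intro j hj
      rcases eq_or_ne j i with rfl | hji
      · simp only [Function.update_self]
        omega
      · rw [Function.update_of_ne hji]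
        exact h j (by have := Fin.val_ne_of_ne hji; omega)

/-- The simplicial coboundary of a cochain, evaluated at a tuple. -/
def delta {l : ℕ} (f : (Fin l → Set α) → ℝ) (K : Fin (l + 1) → Set α) : ℝ :=
  ∑ k : Fin (l + 1), (-1) ^ ((k : ℕ) + 1) * f (K ∘ k.succAbove)

/-- Fix the chain without its `k`-th member. Its completions insert exactly the covers of the lower
neighbour `H` inside the upper neighbour `T`. Modulo `ind H` their rows add up to `ind T`, and
either row makes the form vanish: it repeats another row, is zero, or is `ind G`. -/
lemma sum_face_smul_map_ind [M.Finite] [M.Loopless] {G : Set α} {q : ℕ} (hG : M.IsFlat G)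
    (hq : q + 1 < rk M G) (φ : (α → ℝ) [⋀^Fin (q + 1)]→ₗ[ℝ] N)
    (hφ : ∀ w i, w i = ind G → φ w = 0) (b : (Fin q → Set α) → ℝ) (k : Fin (q + 1)) :
    ∑ K ∈ chainsBelow M G (q + 1) (q + 1), b (K ∘ k.succAbove) • φ (fun i => ind (K i)) = 0 := by
  classical
  rw [← Finset.sum_fiberwise_of_maps_to
    (t := (chainsBelow M G (q + 1) (q + 1)).image fun K => K ∘ k.succAbove)
    (g := fun K => K ∘ k.succAbove) fun K hK => Finset.mem_image_of_mem _ hK]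
  refine Finset.sum_eq_zero fun L hL => ?_
  obtain ⟨K, hK, rfl⟩ := Finset.mem_image.1 hL
  rw [Finset.sum_congr rfl (g := fun K' => b (K ∘ k.succAbove) • φ (fun i => ind (K' i)))
    fun K' hK' => by rw [(Finset.mem_filter.1 hK').2], ← Finset.smul_sum]
  rw [mem_chainsBelow] at hK
  obtain ⟨H, hH, hHK, hHlt, hHeq⟩ := hK.exists_next k
  obtain ⟨T, hT, hKT, hTG, hTgt, hTeq⟩ := hK.exists_prev hG k
  have hrH : rk M H + k = q := by
    rcases hHeq with ⟨rfl, h1⟩ | ⟨j, hj, rfl⟩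
    · simpa using h1
    · have := hK.rk_eq j
      omega
  -- Thus `T` has rank at least two above `H`, which keeps the covers of `H` properly below `T`.
  have hrT : q + 1 < rk M T + k := by
    rcases hTeq with ⟨rfl, h1⟩ | ⟨j, hj, rfl⟩
    · omega
    · have := hK.rk_eq j
      omega
  have h0 : φ (Function.update (fun k => ind (K k)) k (ind H)) = 0 := by
    rcases hHeq with ⟨rfl, h1⟩ | ⟨j, hj, rfl⟩
    · exact map_update_ind_empty φ _ _
    · exact map_update_ind_of_mem φ K (Fin.ne_of_val_ne (by omega))
  have h1 : φ (Function.update (fun k => ind (K k)) k (ind T)) = 0 := by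
    rcases hTeq with ⟨rfl, h1⟩ | ⟨j, hj, rfl⟩
    · exact hφ _ k (by simp)
    · exact map_update_ind_of_mem φ K (Fin.ne_of_val_ne (by omega))
  have hsum := map_update_ind φ _ k hH hT (hHK.subset.trans hKT.subset) h0
  rw [h1] at hsum
  convert smul_zero _
  rw [← hsum]
  have hne : ∀ K' : Fin (q + 1) → Set α, K' ∘ k.succAbove = K ∘ k.succAbove →
      ∀ j, j ≠ k → K' j = K j := by
    intro K' h j hj
    obtain ⟨i, rfl⟩ := Fin.exists_succAbove_eq hj
    exact congrFun h i
  refine Finset.sum_nbij' (fun K' => K' k) (fun F => Function.update K k F) ?_ ?_ ?_ ?_ ?_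
  · intro K' hK'
    obtain ⟨hK', hf⟩ := Finset.mem_filter.1 hK'
    rw [mem_chainsBelow] at hK'
    refine mem_coverFlats.2 ⟨hK'.isFlat k, ?_, ?_, ?_⟩
    · rcases hHeq with ⟨rfl, -⟩ | ⟨j, hj, rfl⟩
      · exact Set.empty_subset _
      · rw [← hne K' hf j (Fin.ne_of_val_ne (by omega))]
        exact hK'.strictAnti.antitone (by rw [Fin.le_def]; omega)
    · rcases hTeq with ⟨rfl, -⟩ | ⟨j, hj, rfl⟩
      · exact (hK'.ssubset k).subset
      · rw [← hne K' hf j (Fin.ne_of_val_ne (by omega))]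
        exact hK'.strictAnti.antitone (by rw [Fin.le_def]; omega)
    · have := hK'.rk_eq k
      omega
  · intro F hF
    obtain ⟨hF, hHF, hFT, hrF⟩ := mem_coverFlats.1 hF
    have hHF' : H ⊂ F := hHF.ssubset_of_ne fun h => by subst h; omega
    have hFT' : F ⊂ T := hFT.ssubset_of_ne fun h => by subst h; omega
    refine Finset.mem_filter.2 ⟨mem_chainsBelow.2 (hK.update hF (Set.nonempty_of_ssubset' hHF')
      (hFT'.trans_subset hTG) (by omega) (fun j hj => (hHlt j hj).trans_ssubset hHF')
      fun j hj => hFT'.trans_subset (hTgt j hj)), ?_⟩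
    ext j : 1
    simp [Fin.succAbove_ne]
  · intro K' hK'
    obtain ⟨hK', hf⟩ := Finset.mem_filter.1 hK'
    ext j : 1
    rcases eq_or_ne j k with rfl | hj
    · simp
    · simp [hj, hne K' hf j hj]
  · intro F hF
    simp
  · intro K' hK'
    obtain ⟨hK', hf⟩ := Finset.mem_filter.1 hK'
    congr 1
    ext j : 1
    rcases eq_or_ne j k with rfl | hj
    · simp
    · simp [hj, hne K' hf j hj]

/-- The wedges of the members of a coboundary add up to zero. -/
lemma sum_delta_smul_map_ind [M.Finite] [M.Loopless] {G : Set α} {q : ℕ} (hG : M.IsFlat G)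
    (hq : q + 1 < rk M G) (φ : (α → ℝ) [⋀^Fin (q + 1)]→ₗ[ℝ] N)
    (hφ : ∀ w i, w i = ind G → φ w = 0) (b : (Fin q → Set α) → ℝ) :
    ∑ K ∈ chainsBelow M G (q + 1) (q + 1), delta b K • φ (fun i => ind (K i)) = 0 := by
  simp only [delta, Finset.sum_smul]
  rw [Finset.sum_comm]
  refine Finset.sum_eq_zero fun k _ => ?_
  simp only [mul_smul]
  rw [← Finset.smul_sum, sum_face_smul_map_ind hG hq φ hφ b k, smul_zero]

end Alternating

/-! ### Minors and their restriction to flats -/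

/-- The alternating form on `α → ℝ` given by the minor with columns `a`. -/
def minor {m : ℕ} (a : Fin m → α) : (α → ℝ) [⋀^Fin m]→ₗ[ℝ] ℝ :=
  Matrix.detRowAlternating.compLinearMap (LinearMap.funLeft ℝ ℝ a)

lemma minor_apply {m : ℕ} (a : Fin m → α) (w : Fin m → α → ℝ) :
    minor a w = Matrix.det (Matrix.of fun i j => w i (a j)) := rfl

/-- The minor with columns `a` of the matrix whose rows are the indicator vectors of `S`. -/
def vol {m : ℕ} (S : Fin m → Set α) (a : Fin m → α) : ℝ := minor a fun i => ind (S i)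

lemma vol_congr {m : ℕ} {S T : Fin m → Set α} {a : Fin m → α}
    (h : ∀ i j, ind (S i) (a j) = ind (T i) (a j)) : vol S a = vol T a := by
  simp only [vol, minor_apply, h]

lemma vol_cons_congr {m : ℕ} {F G : Set α} (K : Fin m → Set α) {a : Fin (m + 1) → α}
    (hF : ∀ j, a j ∈ F) (hG : ∀ j, a j ∈ G) :
    vol (Matrix.vecCons F K) a = vol (Matrix.vecCons G K) a := by
  refine vol_congr fun i j => ?_
  cases i using Fin.cases with
  | zero => simp [ind_of_mem (hF j), ind_of_mem (hG j)]
  | succ i => rfl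

/-- Laplace expansion along the column of `e`, that is, contraction with evaluation at `e`. The row
of `G` contributes coefficient 1 because `e ∈ G`. -/
lemma vol_cons_cons {m : ℕ} {G : Set α} (L : Fin (m + 1) → Set α) {e : α} (he : e ∈ G)
    (a : Fin (m + 1) → α) :
    vol (Matrix.vecCons G L) (Matrix.vecCons e a) = vol L a +
      ∑ i : Fin (m + 1), (-1) ^ ((i : ℕ) + 1) * ind (L i) e *
        vol (Matrix.vecCons G (L ∘ i.succAbove)) a := by
  rw [vol, minor_apply, Matrix.det_succ_column_zero, Fin.sum_univ_succ]
  congr 1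
  · simp [ind_of_mem he, vol, minor_apply]
    rfl
  · refine Finset.sum_congr rfl fun i _ => ?_
    congr 1
    rw [vol, minor_apply]
    congr 1
    ext j k
    cases j using Fin.cases with
    | zero => simp
    | succ j => simp

/-- A minor of the indicator vectors of a flag of flats with columns in a flat `F` vanishes unless
the restrictions to `F` have large rank. -/
lemma le_rk_inter_of_vol_ne_zero [M.Finite] [M.Loopless] {m : ℕ} {S : Fin m → Set α}
    {F : Set α} {a : Fin m → α} (hS : ∀ i, M.IsFlat (S i)) (ha : Antitone S) (hF : M.IsFlat F)
    (haF : ∀ j, a j ∈ F) (h : vol S a ≠ 0) (i : Fin m) : m ≤ rk M (S i ∩ F) + i := by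
  -- With columns in `F` the rows may be cut down to `F`; two equal rows or a zero row would then
  -- kill the minor.
  have h' : vol (fun i => S i ∩ F) a ≠ 0 := by
    rwa [vol_congr (T := S) fun i j => ind_inter_of_mem (haF j)]
  refine le_rk_of_strictAnti (K := fun i => S i ∩ F) (fun i => isFlat_inter (hS i) hF) ?_ ?_ i
  · refine Antitone.strictAnti_of_injective
      (fun i j hij => Set.inter_subset_inter_left _ (ha hij)) fun i j hij => ?_
    by_contra hne
    exact h' (AlternatingMap.map_eq_zero_of_eq _ _ (congrArg ind hij) hne)
  · intro i
    rw [Set.nonempty_iff_ne_empty]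
    intro hi
    exact h' (AlternatingMap.map_coord_zero _ i ((congrArg ind hi).trans ind_empty))

lemma antitone_cons {l : ℕ} {G : Set α} {K : Fin l → Set α} (hK : Antitone K)
    (h : ∀ i, K i ⊆ G) : Antitone (Matrix.vecCons G K) := by
  intro i j hij
  cases i using Fin.cases with
  | zero =>
    cases j using Fin.cases with
    | zero => exact le_rfl
    | succ j => exact h j
  | succ i =>
    cases j using Fin.cases with
    | zero => exact absurd hij (by simp)
    | succ j => exact hK (Fin.succ_le_succ_iff.1 hij)

/-- Restriction of the total volume of a cochain to a smaller flat. -/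
lemma sum_vol_restrict [M.Finite] [M.Loopless] {F G : Set α} {q : ℕ} (hF : M.IsFlat F)
    (hG : M.IsFlat G) (hFG : F ⊆ G) (hr : rk M F = q + 1) (c : (Fin q → Set α) → ℝ)
    {a : Fin (q + 1) → α} (ha : ∀ j, a j ∈ F) :
    ∑ K ∈ chainsBelow M G q q, c K * vol (Matrix.vecCons G K) a =
      ∑ K ∈ chainsBelow M F q q, c K * vol (Matrix.vecCons F K) a := by
  simp only [vol_cons_congr _ (fun j => hFG (ha j)) ha]
  refine (Finset.sum_subset (fun K hK => ?_) fun K hK hK' => ?_).symm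
  · rw [mem_chainsBelow] at *
    exact ⟨hK.isFlat, hK.strictAnti, hK.nonempty, fun i => (hK.ssubset i).trans_subset hFG,
      hK.rk_le⟩
  · rw [mem_chainsBelow] at *
    by_contra hne
    have hv : vol (Matrix.vecCons G K) a ≠ 0 := by
      rw [vol_cons_congr K (fun j => hFG (ha j)) ha]
      exact right_ne_zero_of_mul hne
    refine hK' ⟨hK.isFlat, hK.strictAnti, hK.nonempty, fun i => ?_, hK.rk_le⟩
    -- `K i` has rank at most `q - i`, its intersection with `F` at least that; so `K i ⊆ F`.
    have h1 := le_rk_inter_of_vol_ne_zero (M := M) (Fin.cases hG hK.isFlat)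
      (antitone_cons hK.strictAnti.antitone fun i => (hK.ssubset i).subset) hF ha hv i.succ
    have h2 := hK.rk_add i
    simp only [Matrix.cons_val_succ, Fin.val_succ] at h1
    have h3 := eq_of_subset_of_rk_le (isFlat_inter (hK.isFlat i) hF) (hK.isFlat i)
      Set.inter_subset_left (by omega)
    refine (Set.inter_eq_left.1 h3).ssubset_of_ne fun h => ?_
    rw [h] at h2
    omega

/-- Restriction of the total volume of a top-degree cochain to a flat of the maximal rank. -/
lemma sum_vol_restrict_top [M.Finite] [M.Loopless] {F G : Set α} {q : ℕ} (hF : M.IsFlat F)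
    (hFG : F ⊂ G) (hr : rk M F = q + 1) (c : (Fin (q + 1) → Set α) → ℝ)
    {a : Fin (q + 1) → α} (ha : ∀ j, a j ∈ F) :
    ∑ L ∈ chainsBelow M G (q + 1) (q + 1), c L * vol L a =
      ∑ K ∈ chainsBelow M F q q, c (Matrix.vecCons F K) * vol (Matrix.vecCons F K) a := by
  classical
  have hinj : Set.InjOn (fun K : Fin q → Set α => Matrix.vecCons F K)
      (chainsBelow M F q q : Set (Fin q → Set α)) :=
    fun K _ K' _ h => funext fun i => congrFun h i.succ
  rw [← Finset.sum_image (f := fun L => c L * vol L a) hinj]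
  refine (Finset.sum_subset (fun L hL => ?_) fun L hL hL' => ?_).symm
  · obtain ⟨K, hK, rfl⟩ := Finset.mem_image.1 hL
    rw [mem_chainsBelow] at *
    exact hK.cons hF (Set.nonempty_iff_ne_empty.2 fun h => by simp [h] at hr) hFG
      (Nat.le_succ q) hr.le
  · rw [mem_chainsBelow] at hL
    by_contra hne
    -- The head has rank at most `q + 1` and meets `F` in rank at least `q + 1`, hence equals `F`.
    have h1 := le_rk_inter_of_vol_ne_zero hL.isFlat hL.strictAnti.antitone hF ha
      (right_ne_zero_of_mul hne) 0
    have h2 := hL.rk_le 0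
    simp only [Fin.val_zero, add_zero] at h1
    have h3 := eq_of_subset_of_rk_le (isFlat_inter (hL.isFlat 0) hF) (hL.isFlat 0)
      Set.inter_subset_left (by omega)
    have h4 := eq_of_subset_of_rk_le (hL.isFlat 0) hF (Set.inter_eq_left.1 h3)
      (by rw [h3] at h1; omega)
    have h5 : L = Matrix.vecCons F (fun i => L i.succ) := by
      ext i : 1
      cases i using Fin.cases with
      | zero => exact h4
      | succ i => rfl
    refine hL' (Finset.mem_image.2 ⟨fun i => L i.succ, ?_, h5.symm⟩)
    rw [h5] at hL
    exact mem_chainsBelow.2 (hL.tail hr.le)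

/-! ### Coboundaries and their gluing -/

lemma delta_congr {l : ℕ} {f g : (Fin l → Set α) → ℝ} {K : Fin (l + 1) → Set α}
    (h : ∀ k : Fin (l + 1), f (K ∘ k.succAbove) = g (K ∘ k.succAbove)) : delta f K = delta g K := by
  simp only [delta, h]

lemma delta_neg {l : ℕ} (f : (Fin l → Set α) → ℝ) (K : Fin (l + 1) → Set α) :
    delta (fun K => - f K) K = - delta f K := by
  simp [delta]

lemma delta_add {l : ℕ} (f g : (Fin l → Set α) → ℝ) (K : Fin (l + 1) → Set α) :
    delta (fun K => f K + g K) K = delta f K + delta g K := by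
  simp [delta, mul_add, Finset.sum_add_distrib]

lemma delta_of_zero (f : (Fin 0 → Set α) → ℝ) (K : Fin 1 → Set α) (K' : Fin 0 → Set α) :
    delta f K = - f K' := by
  simp [delta, Subsingleton.elim (K ∘ Fin.succ) K']

/-- Omitting the head gives the first term. This recursion relates a cochain below `F` to its values
on chains headed by `F`. -/
lemma delta_cons {l : ℕ} (f : (Fin (l + 1) → Set α) → ℝ) (F : Set α) (K : Fin (l + 1) → Set α) :
    delta f (Matrix.vecCons F K) = - f K - delta (fun K' => f (Matrix.vecCons F K')) K := by
  rw [delta, Fin.sum_univ_succ, delta, sub_eq_add_neg, ← Finset.sum_neg_distrib]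
  congr 1
  · simp only [Fin.val_zero, zero_add, pow_one, neg_mul, one_mul]
    rfl
  · refine Finset.sum_congr rfl fun k _ => ?_
    have : Matrix.vecCons F K ∘ k.succ.succAbove = Matrix.vecCons F (K ∘ k.succAbove) := by
      ext i : 1
      cases i using Fin.cases with
      | zero => simp
      | succ i => simp
    rw [this, Fin.val_succ, pow_succ]
    ring

lemma cons_head_tail {l : ℕ} (K : Fin (l + 1) → Set α) :
    Matrix.vecCons (K 0) (fun i => K i.succ) = K := by
  ext i : 1
  cases i using Fin.cases <;> rfl

lemma delta_delta : ∀ {l : ℕ} (f : (Fin l → Set α) → ℝ) (K : Fin (l + 2) → Set α),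
    delta (delta f) K = 0
  | 0, f, K => by
    rw [← cons_head_tail K, delta_cons, delta_of_zero _ _ Fin.elim0, delta_of_zero _ _ Fin.elim0,
      delta_of_zero _ _ Fin.elim0]
    ring
  | l + 1, f, K => by
    rw [← cons_head_tail K, delta_cons]
    simp only [delta_cons, sub_eq_add_neg, delta_add, delta_neg, delta_delta]
    ring

/-- A cochain is a coboundary on the chains of flats below `G` of rank at most `p`; in degree zero
this means that it vanishes. -/
def IsCob (M : Matroid α) (G : Set α) (p : ℕ) : ∀ {l : ℕ}, ((Fin l → Set α) → ℝ) → Prop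
  | 0, c => ∀ K, c K = 0
  | l + 1, c => ∃ b : (Fin l → Set α) → ℝ, ∀ K : Fin (l + 1) → Set α,
      IsChainBelow M G p K → c K = delta b K

/-- With `ind G` fixed as first row, the minor vanishes when `ind G` occurs again, as
`sum_delta_smul_map_ind` demands. -/
lemma IsCob.sum_vol_eq_zero [M.Finite] [M.Loopless] {G : Set α} (hG : M.IsFlat G) {q : ℕ}
    (hq : q < rk M G) {c : (Fin q → Set α) → ℝ} (hc : IsCob M G q c) (a : Fin (q + 1) → α) :
    ∑ K ∈ chainsBelow M G q q, c K * vol (Matrix.vecCons G K) a = 0 := by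
  cases q with
  | zero => exact Finset.sum_eq_zero fun K _ => by rw [hc K, zero_mul]
  | succ q =>
    obtain ⟨b, hb⟩ := hc
    rw [← sum_delta_smul_map_ind hG hq ((minor a).curryLeft (ind G)) ?_ b]
    · refine Finset.sum_congr rfl fun K hK => ?_
      rw [hb K (mem_chainsBelow.1 hK), AlternatingMap.curryLeft_apply_apply, smul_eq_mul, vol]
      congr 2
      ext i : 1
      cases i using Fin.cases <;> rfl
    · intro w i hw
      rw [AlternatingMap.curryLeft_apply_apply]
      exact AlternatingMap.map_eq_zero_of_eq _ _ (i := 0) (j := i.succ) (by simp [hw])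
        (Fin.succ_ne_zero i).symm

/-- A cocycle restricts to a coboundary on each flat. -/
lemma isCob_of_delta_cons_eq_zero {F : Set α} {p l : ℕ} {c : (Fin l → Set α) → ℝ}
    (h : ∀ K : Fin l → Set α, IsChainBelow M F p K → delta c (Matrix.vecCons F K) = 0) :
    IsCob M F p c := by
  cases l with
  | zero =>
    intro K
    have := h K (IsChainBelow.of_elim K)
    rwa [delta_of_zero _ _ K, neg_eq_zero] at this
  | succ l =>
    -- Solving `delta_cons` for `c K` gives this primitive.
    refine ⟨fun K' => - c (Matrix.vecCons F K'), fun K hK => ?_⟩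
    have := h K hK
    rw [delta_cons] at this
    rw [delta_neg]
    linarith

/-- Gluing of coboundaries over the flats of rank `p + 1`. -/
lemma isCob_of_forall_isFlat [M.Finite] {G : Set α} {p l : ℕ} {c : (Fin (l + 1) → Set α) → ℝ}
    (b : (Fin l → Set α) → ℝ)
    (h : ∀ F, M.IsFlat F → F ⊂ G → rk M F = p + 1 →
      IsCob M F p fun K => c (Matrix.vecCons F K) + b K)
    (h0 : ∀ K : Fin (l + 1) → Set α, IsChainBelow M G p K → c K = delta b K) :
    IsCob M G (p + 1) c := by
  cases l with
  | zero =>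
    refine ⟨b, fun K hK => ?_⟩
    by_cases hr : rk M (K 0) ≤ p
    · exact h0 K (hK.of_head_le hr)
    · have h1 := h _ (hK.isFlat 0) (hK.ssubset 0) (by have := hK.rk_le 0; omega)
        (fun i => K i.succ)
      simp only [cons_head_tail] at h1
      rw [delta_of_zero b K fun i => K i.succ]
      linarith
  | succ l =>
    have : ∀ F, ∃ b' : (Fin l → Set α) → ℝ, M.IsFlat F → F ⊂ G → rk M F = p + 1 →
        ∀ K : Fin (l + 1) → Set α, IsChainBelow M F p K →
          c (Matrix.vecCons F K) + b K = delta b' K := by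
      intro F
      by_cases hF : M.IsFlat F ∧ F ⊂ G ∧ rk M F = p + 1
      · obtain ⟨b', hb'⟩ := h F hF.1 hF.2.1 hF.2.2
        exact ⟨b', fun _ _ _ => hb'⟩
      · exact ⟨0, fun h1 h2 h3 => absurd ⟨h1, h2, h3⟩ hF⟩
    choose β hβ using this
    -- The sign offsets the one in `delta_cons`. The face that omits a head of rank `p + 1` is
    -- evaluated by `b`, which explains the summand `b K` in `h`.
    refine ⟨fun K => if rk M (K 0) = p + 1 then - β (K 0) (fun i => K i.succ) else b K,
      fun K hK => ?_⟩
    by_cases hr : rk M (K 0) ≤ p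
    · rw [h0 K (hK.of_head_le hr)]
      refine delta_congr fun k => ?_
      rw [if_neg]
      have := ((hK.of_head_le hr).comp_succAbove k).rk_le 0
      omega
    · have hr : rk M (K 0) = p + 1 := by have := hK.rk_le 0; omega
      have hK0 := hK
      rw [← cons_head_tail K] at hK0
      have htail := hK0.tail hr.le
      have h1 := hβ _ (hK.isFlat 0) (hK.ssubset 0) hr _ htail
      conv_rhs => rw [← cons_head_tail K, delta_cons]
      rw [if_neg (Nat.lt_succ_of_le (htail.rk_le 0)).ne]
      simp only [Matrix.cons_val_zero, Matrix.cons_val_succ, hr, if_true, delta_neg]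
      rw [cons_head_tail] at h1
      linarith

/-! ### The induction -/

/-- The volumes with a fixed first row, as an alternating map with values in functions of the
columns. -/
def volFamily (G : Set α) (q : ℕ) : (α → ℝ) [⋀^Fin q]→ₗ[ℝ] ((Fin (q + 1) → α) → ℝ) :=
  AlternatingMap.pi fun a => (minor a).curryLeft (ind G)

lemma volFamily_apply (G : Set α) {q : ℕ} (K : Fin q → Set α) (a : Fin (q + 1) → α) :
    volFamily G q (fun i => ind (K i)) a = vol (Matrix.vecCons G K) a := by
  rw [vol]
  change minor a (Matrix.vecCons (ind G) fun i => ind (K i)) = _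
  congr 1
  ext i : 1
  cases i using Fin.cases <;> rfl

/-- If the total volume of a top-degree cochain vanishes after multiplication with the indicator
vector of `G`, then it comes from a cochain of lower degree. -/
lemma exists_sum_vol_eq [M.Finite] [M.Loopless] {G : Set α} {q : ℕ} (hne : G.Nonempty)
    {c : (Fin (q + 1) → Set α) → ℝ}
    (h : ∀ a : Fin (q + 2) → α, (∀ j, a j ∈ G) →
      ∑ L ∈ chainsBelow M G (q + 1) (q + 1), c L * vol (Matrix.vecCons G L) a = 0) :
    ∃ b : (Fin q → Set α) → ℝ, ∀ a : Fin (q + 1) → α, (∀ j, a j ∈ G) →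
      ∑ K ∈ chainsBelow M G q q, b K * vol (Matrix.vecCons G K) a =
        - ∑ L ∈ chainsBelow M G (q + 1) (q + 1), c L * vol L a := by
  obtain ⟨e, he⟩ := hne
  -- This contracts with `e`. Deleting a member leaves length `q` but ranks up to `q + 1`, so
  -- `map_ind_mem_span` lowers the ranks. Values in functions of the columns ensure that one `b`
  -- serves all `a`.
  have hy : (∑ L ∈ chainsBelow M G (q + 1) (q + 1), c L • ∑ i : Fin (q + 1),
      ((-1 : ℝ) ^ ((i : ℕ) + 1) * ind (L i) e) •
        volFamily G q fun j => ind ((L ∘ i.succAbove) j)) ∈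
      Submodule.span ℝ ((fun K : Fin q → Set α => volFamily G q fun i => ind (K i)) ''
        (chainsBelow M G q q : Set (Fin q → Set α))) :=
    Submodule.sum_mem _ fun L hL => Submodule.smul_mem _ _ <| Submodule.sum_mem _ fun i _ =>
      Submodule.smul_mem _ _ (map_ind_mem_span _ ((mem_chainsBelow.1 hL).comp_succAbove i))
  obtain ⟨b, hb⟩ := Submodule.mem_span_image_finset_iff_exists_fun' ℝ |>.1 hy
  refine ⟨b, fun a ha => ?_⟩
  have h1 := congrFun hb a
  have h2 := h (Matrix.vecCons e a) (Fin.cases he ha)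
  simp only [vol_cons_cons _ he, mul_add, Finset.sum_add_distrib] at h2
  simp only [Finset.sum_apply, Pi.smul_apply, volFamily_apply, smul_eq_mul] at h1
  rw [h1]
  linarith

/-- Acyclicity of the cochain complex of the chains of flats of rank at most `p` below a flat of
larger rank. -/
theorem isCob_of_cocycle [M.Finite] [M.Loopless] (p : ℕ) : ∀ {G : Set α}, M.IsFlat G →
    p < rk M G →
    (∀ {l : ℕ} (c : (Fin l → Set α) → ℝ), l < p →
      (∀ K : Fin (l + 1) → Set α, IsChainBelow M G p K → delta c K = 0) → IsCob M G p c) ∧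
    (∀ c : (Fin p → Set α) → ℝ,
      (∀ a : Fin (p + 1) → α, (∀ j, a j ∈ G) →
        ∑ K ∈ chainsBelow M G p p, c K * vol (Matrix.vecCons G K) a = 0) → IsCob M G p c) := by
  induction p with
  | zero =>
    intro G hG hr
    refine ⟨fun c hl => absurd hl (Nat.not_lt_zero _), fun c h K => ?_⟩
    obtain ⟨e, he⟩ : G.Nonempty := Set.nonempty_iff_ne_empty.2 fun h => by simp [h] at hr
    have h1 := h (fun _ => e) fun _ => he
    rw [Finset.sum_eq_single K (fun K' _ h => absurd (Subsingleton.elim K' K) h)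
      fun h => absurd (mem_chainsBelow.2 (IsChainBelow.of_elim K)) h] at h1
    simpa [vol, minor_apply, ind_of_mem he] using h1
  | succ p ih =>
    intro G hG hr
    have hrF : ∀ {F}, rk M F = p + 1 → p < rk M F := fun h => by omega
    have hneF : ∀ {F}, rk M F = p + 1 → F.Nonempty := fun {F} h =>
      Set.nonempty_iff_ne_empty.2 fun h' => by simp [h'] at h
    constructor
    · intro l c hl hc
      have hlocal : ∀ F, M.IsFlat F → F ⊂ G → rk M F = p + 1 → ∀ K : Fin l → Set α,
          IsChainBelow M F p K → delta c (Matrix.vecCons F K) = 0 := fun F hF hFG hFr K hK =>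
        hc _ (hK.cons hF (hneF hFr) hFG (Nat.le_succ p) hFr.le)
      have h0 : IsCob M G p c := by
        rcases Nat.lt_succ_iff_lt_or_eq.1 hl with hl | rfl
        · exact (ih hG (by omega)).1 c hl fun K hK => hc K (hK.mono (Nat.le_succ p))
        · refine (ih hG (by omega)).2 c fun a ha => ?_
          have hcard : rk M (Set.range a) ≤ l + 1 := by
            have := M.eRk_le_encard (Set.range a)
            rw [← coe_rk, ← Set.image_univ] at this
            have := this.trans (Set.encard_image_le a Set.univ)
            simp only [Set.encard_univ, ENat.card_eq_coe_fintype_card, Fintype.card_fin] at this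
            rw [Set.image_univ] at this
            exact_mod_cast this
          -- `F` is proper in `G` by rank, so the cocycle condition on chains headed by `F` is
          -- available.
          obtain ⟨F, hF, haF, hFG, hFr⟩ := exists_isFlat_rk_eq hG hr.le
            (Set.range_subset_iff.2 ha) hcard
          have haF := Set.range_subset_iff.1 haF
          rw [sum_vol_restrict hF hG hFG hFr c haF]
          have hFG' : F ⊂ G := hFG.ssubset_of_ne fun h => by subst h; omega
          exact (isCob_of_delta_cons_eq_zero (hlocal F hF hFG' hFr)).sum_vol_eq_zero hF (hrF hFr) a
      cases l with
      | zero =>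
        exact h0
      | succ l =>
        obtain ⟨b, hb⟩ := h0
        refine isCob_of_forall_isFlat b (fun F hF hFG hFr => ?_) hb
        refine (ih hF (hrF hFr)).1 _ (by omega) fun K hK => ?_
        have h1 := hlocal F hF hFG hFr K hK
        have h2 := hb K ⟨hK.isFlat, hK.strictAnti, hK.nonempty,
          fun i => (hK.ssubset i).trans hFG, hK.rk_le⟩
        rw [delta_cons] at h1
        rw [delta_add]
        linarith
    · intro c hc
      obtain ⟨b, hb⟩ := exists_sum_vol_eq
        (Set.nonempty_iff_ne_empty.2 fun h' => by simp [h'] at hr) hc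
      refine isCob_of_forall_isFlat b (fun F hF hFG hFr => ?_) fun K hK => ?_
      · refine (ih hF (hrF hFr)).2 _ fun a ha => ?_
        simp only [add_mul, Finset.sum_add_distrib]
        rw [← sum_vol_restrict_top hF hFG hFr c ha, ← sum_vol_restrict hF hG hFG.subset hFr b ha,
          hb a fun j => hFG.subset (ha j)]
        ring
      -- No chain of length `p + 1` has all ranks at most `p`: its last member would have rank 0.
      · have := hK.rk_add (Fin.last p)
        have := rk_pos (hK.isFlat (Fin.last p)) (hK.nonempty _)
        simp only [Fin.val_last] at *
        omega

/-! ### Translation to formal combinations of chains -/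

lemma isFlatChain_and_iff [M.Finite] {p l : ℕ} {K : Fin l → Set α} :
    (IsFlatChain M K ∧ ∀ i, M.eRk (K i) ≤ p) ↔ IsChainBelow M M.E p K := by
  have h : ∀ i, M.eRk (K i) ≤ p ↔ rk M (K i) ≤ p := fun i => by
    rw [← coe_rk]
    exact Nat.cast_le
  simp only [h]
  exact ⟨fun ⟨h1, h2⟩ => ⟨h1.isFlat, h1.strictAnti, h1.nonempty,
      fun i => (h1.isFlat i).subset_ground.ssubset_of_ne (h1.ne_ground i), h2⟩,
    fun h => ⟨⟨h.isFlat, h.strictAnti, h.nonempty, fun i => (h.ssubset i).ne⟩, h.rk_le⟩⟩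

open Classical in
/-- The function on tuples of sets given by a formal combination of chains. -/
def toCochain {p l : ℕ} (c : Chain M p l →₀ ℝ) (K : Fin l → Set α) : ℝ :=
  if h : IsFlatChain M K ∧ ∀ i, M.eRk (K i) ≤ p then c ⟨K, h⟩ else 0

lemma toCochain_val {p l : ℕ} (c : Chain M p l →₀ ℝ) (F : Chain M p l) :
    toCochain c F.1 = c F := dif_pos F.2

/-- The formal combination of chains given by a function on tuples of sets. -/
def ofCochain (M : Matroid α) [M.Finite] (p : ℕ) {l : ℕ} (b : (Fin l → Set α) → ℝ) :
    Chain M p l →₀ ℝ :=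
  Finsupp.equivFunOnFinite.symm fun F => b F.1

lemma toCochain_ofCochain [M.Finite] {p l : ℕ} (b : (Fin l → Set α) → ℝ) (F : Chain M p l) :
    toCochain (ofCochain M p b) F.1 = b F.1 := by
  rw [toCochain_val]
  rfl

lemma coboundary_apply [M.Finite] {p l : ℕ} (c : Chain M p l →₀ ℝ) (G : Chain M p (l + 1)) :
    coboundary M p l c G = delta (toCochain c) G.1 := by
  classical
  have h : coboundary M p l c G = ∑ F : Chain M p l, c F * incidence F G := by
    rw [coboundary, Finsupp.linearCombination_apply, Finsupp.sum_fintype _ _ (by simp),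
      Finsupp.finsetSum_apply]
    refine Finset.sum_congr rfl fun F _ => ?_
    rw [Finsupp.smul_apply, Finsupp.finsetSum_apply, smul_eq_mul]
    congr 1
    rw [Finset.sum_eq_single G (fun G' _ hne => Finsupp.single_eq_of_ne hne.symm) (by simp),
      Finsupp.single_eq_same]
  rw [h, delta]
  simp only [incidence, Finset.mul_sum]
  rw [Finset.sum_comm]
  refine Finset.sum_congr rfl fun k _ => ?_
  rw [Finset.sum_eq_single (G.face k) (fun F _ hne => by rw [if_neg hne.symm, mul_zero])
    (by simp), if_pos rfl, ← toCochain_val, mul_comm]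
  rfl

lemma coboundary_coboundary [M.Finite] {p l : ℕ} (c : Chain M p l →₀ ℝ) :
    coboundary M p (l + 1) (coboundary M p l c) = 0 := by
  ext G
  rw [coboundary_apply, Finsupp.zero_apply, ← delta_delta (toCochain c) G.1]
  refine delta_congr fun k => ?_
  exact (toCochain_val _ (G.face k)).trans (coboundary_apply c (G.face k))

lemma isCob_toCochain_iff [M.Finite] {p l : ℕ} {c : Chain M p (l + 1) →₀ ℝ} :
    IsCob M M.E p (toCochain c) ↔ c ∈ Set.range (coboundary M p l) := by
  constructor
  · rintro ⟨b, hb⟩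
    refine ⟨ofCochain M p b, ?_⟩
    ext G
    rw [coboundary_apply, ← toCochain_val c, hb _ (isFlatChain_and_iff.1 G.2)]
    exact delta_congr fun k => toCochain_ofCochain b (G.face k)
  · rintro ⟨b, rfl⟩
    refine ⟨toCochain b, fun K hK => ?_⟩
    exact (toCochain_val _ ⟨K, isFlatChain_and_iff.2 hK⟩).trans (coboundary_apply b _)

lemma eq_zero_of_isCob_toCochain {p : ℕ} {c : Chain M p 0 →₀ ℝ}
    (h : IsCob M M.E p (toCochain c)) : c = 0 := by
  ext F
  rw [← toCochain_val]
  exact h F.1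

lemma delta_toCochain_eq_zero [M.Finite] {p l : ℕ} {c : Chain M p l →₀ ℝ}
    (h : coboundary M p l c = 0) (K : Fin (l + 1) → Set α) (hK : IsChainBelow M M.E p K) :
    delta (toCochain c) K = 0 := by
  let G : Chain M p (l + 1) := ⟨K, isFlatChain_and_iff.2 hK⟩
  have := coboundary_apply c G
  rwa [h, Finsupp.zero_apply, eq_comm] at this

/-! ### The volume map and its kernel -/

/-- The projection of `ℝ^α` to `ℝ^E / ℝ𝟏`. -/
def toAmbient (M : Matroid α) : (α → ℝ) →ₗ[ℝ] Ambient M :=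
  (Submodule.mkQ _).comp (LinearMap.funLeft ℝ ℝ ((↑) : M.E → α))

lemma toAmbient_ind (S : Set α) : toAmbient M (ind S) = vec M S := by
  simp only [toAmbient, vec, LinearMap.comp_apply, Submodule.mkQ_apply]
  congr 1

lemma toAmbient_ind_ground : toAmbient M (ind M.E) = 0 := by
  rw [toAmbient, LinearMap.comp_apply, Submodule.mkQ_apply, Submodule.Quotient.mk_eq_zero]
  convert Submodule.mem_span_singleton_self (1 : M.E → ℝ)
  ext e
  exact ind_of_mem e.2

/-- The wedge of the classes in `ℝ^E / ℝ𝟏`. -/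
def wedge (M : Matroid α) (l : ℕ) : (α → ℝ) [⋀^Fin l]→ₗ[ℝ] (⋀[ℝ]^l (Ambient M)) :=
  (exteriorPower.ιMulti ℝ l).compLinearMap (toAmbient M)

lemma wedge_ind {l : ℕ} (K : Fin l → Set α) :
    wedge M l (fun i => ind (K i)) = exteriorPower.ιMulti ℝ l fun i => vec M (K i) := by
  simp only [wedge, AlternatingMap.compLinearMap_apply, toAmbient_ind]

lemma coe_volumeMap [M.Finite] {p l : ℕ} (c : Chain M p l →₀ ℝ) :
    (volumeMap M p l c : ⋀[ℝ]^l (Ambient M)) =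
      ∑ K ∈ chainsBelow M M.E p l, toCochain c K • wedge M l fun i => ind (K i) := by
  rw [volumeMap, Finsupp.linearCombination_apply, Finsupp.sum_fintype _ _ (by simp),
    AddSubmonoidClass.coe_finsetSum,
    Finset.sum_subtype (F := inferInstanceAs (Fintype (Chain M p l))) _
      fun K => mem_chainsBelow.trans isFlatChain_and_iff.symm]
  refine Finset.sum_congr rfl fun F _ => ?_
  rw [wedge_ind, toCochain_val]
  rfl

lemma volumeMap_coboundary [M.Finite] [M.Loopless] {q : ℕ} (hq : q + 1 < rk M M.E)
    (c : Chain M (q + 1) q →₀ ℝ) : volumeMap M (q + 1) (q + 1) (coboundary M (q + 1) q c) = 0 := by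
  refine Subtype.ext ?_
  rw [coe_volumeMap, ZeroMemClass.coe_zero, ← sum_delta_smul_map_ind M.ground_isFlat hq
    (wedge M (q + 1)) (fun w i hw => ?_) (toCochain c)]
  · refine Finset.sum_congr rfl fun K hK => ?_
    rw [mem_chainsBelow, ← isFlatChain_and_iff] at hK
    congr 1
    exact (toCochain_val _ ⟨K, hK⟩).trans (coboundary_apply c _)
  -- The class of `ind M.E` is zero in the quotient by 𝟏.
  · exact (exteriorPower.ιMulti ℝ (q + 1)).map_coord_zero i
      ((congrArg (toAmbient M) hw).trans toAmbient_ind_ground)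

/-- The minors with first row `𝟏` factor through the exterior power of `ℝ^E / ℝ𝟏`. -/
lemma exists_linearMap_wedge_eq_vol {q : ℕ} (a : Fin (q + 1) → α) (ha : ∀ j, a j ∈ M.E) :
    ∃ ψ : ⋀[ℝ]^q (Ambient M) →ₗ[ℝ] ℝ, ∀ K : Fin q → Set α,
      ψ (wedge M q fun i => ind (K i)) = vol (Matrix.vecCons M.E K) a := by
  obtain ⟨s, hs⟩ := LinearMap.exists_rightInverse_of_surjective
    (Submodule.mkQ (Submodule.span ℝ {(1 : M.E → ℝ)})) (Submodule.range_mkQ _)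
  let a' : Fin (q + 1) → M.E := fun j => ⟨a j, ha j⟩
  refine ⟨exteriorPower.alternatingMapLinearEquiv
    (((minor a').curryLeft (1 : M.E → ℝ)).compLinearMap s), fun K => ?_⟩
  rw [wedge, AlternatingMap.compLinearMap_apply,
    exteriorPower.alternatingMapLinearEquiv_apply_ιMulti, AlternatingMap.compLinearMap_apply,
    AlternatingMap.curryLeft_apply_apply, vol, minor_apply, minor_apply]
  have h : ∀ i, ∃ r : ℝ, ∀ e : M.E, s (toAmbient M (ind (K i))) e = ind (K i) e + r := by
    intro i
    have h1 := LinearMap.congr_fun hs (toAmbient M (ind (K i)))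
    rw [LinearMap.comp_apply, LinearMap.id_apply] at h1
    conv_rhs at h1 => rw [toAmbient, LinearMap.comp_apply]
    rw [Submodule.mkQ_apply, Submodule.mkQ_apply, Submodule.Quotient.eq,
      Submodule.mem_span_singleton] at h1
    obtain ⟨r, hr⟩ := h1
    refine ⟨r, fun e => ?_⟩
    have := congrFun hr e
    simp only [Pi.smul_apply, Pi.one_apply, smul_eq_mul, mul_one, Pi.sub_apply,
      LinearMap.funLeft_apply] at this
    linarith
  choose r hr using h
  -- The lift by `s` differs from `ind (K i)` on the ground set by the constant `r i`, a multiple of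
  -- the first row 𝟏, which does not change the determinant.
  refine Matrix.det_eq_of_forall_row_eq_smul_add_const (Matrix.vecCons 0 r) 0 rfl fun i j => ?_
  cases i using Fin.cases with
  | zero => simp [ind_of_mem (ha j)]
  | succ i => simpa [ind_of_mem (ha j)] using hr i (a' j)

lemma sum_vol_eq_zero_of_volumeMap_eq_zero [M.Finite] {q : ℕ} {c : Chain M q q →₀ ℝ}
    (h : volumeMap M q q c = 0) (a : Fin (q + 1) → α) (ha : ∀ j, a j ∈ M.E) :
    ∑ K ∈ chainsBelow M M.E q q, toCochain c K * vol (Matrix.vecCons M.E K) a = 0 := by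
  obtain ⟨ψ, hψ⟩ := exists_linearMap_wedge_eq_vol a ha
  have h1 := congrArg (fun x : framingGroup M q => ψ (x : ⋀[ℝ]^q (Ambient M))) h
  simpa only [coe_volumeMap, ZeroMemClass.coe_zero, map_zero, map_sum, map_smul, hψ,
    smul_eq_mul] using h1

/-! ### Surjectivity onto the framing group -/

/-- An alternating map on vectors in the span of a family takes values in the span of its values
on the increasing subfamilies. -/
lemma map_mem_of_forall_strictMono {R V N : Type*} [CommRing R] [AddCommGroup V] [Module R V]
    [AddCommGroup N] [Module R N] {q l : ℕ} (φ : V [⋀^Fin q]→ₗ[R] N) (v : Fin l → V)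
    (P : Submodule R N) (h : ∀ g : Fin q → Fin l, StrictMono g → φ (v ∘ g) ∈ P)
    {w : Fin q → V} (hw : ∀ i, w i ∈ Submodule.span R (Set.range v)) : φ w ∈ P := by
  simp only [Submodule.mem_span_range_iff_exists_fun] at hw
  choose c hc using hw
  rw [← funext hc]
  have := φ.toMultilinearMap.map_sum fun i j => c i j • v j
  simp only [AlternatingMap.coe_multilinearMap] at this
  rw [this]
  refine Submodule.sum_mem _ fun g _ => ?_
  have := φ.toMultilinearMap.map_smul_univ (fun i => c i (g i)) fun i => v (g i)
  simp only [AlternatingMap.coe_multilinearMap] at this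
  rw [this]
  refine Submodule.smul_mem _ _ ?_
  -- Sorting an injective `g` costs only a sign; a repetition gives zero.
  by_cases hg : Function.Injective g
  · have h1 := h (g ∘ Tuple.sort g)
      ((Tuple.monotone_sort g).strictMono_of_injective (hg.comp (Tuple.sort g).injective))
    rw [← Function.comp_assoc, φ.map_perm] at h1
    rcases Int.units_eq_one_or (Equiv.Perm.sign (Tuple.sort g)) with h2 | h2
    · simpa [h2, Function.comp_def] using h1
    · simpa [h2, Function.comp_def] using h1
  · rw [Function.not_injective_iff] at hg
    obtain ⟨i, j, hij, hne⟩ := hg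
    rw [φ.map_eq_zero_of_eq _ (congrArg v hij) hne]
    exact P.zero_mem

lemma cone_le_span {l : ℕ} (F : Fin l → Set α) {x : Ambient M} (hx : x ∈ cone M F) :
    x ∈ Submodule.span ℝ (Set.range fun i => vec M (F i)) := by
  have : cone M F ≤ (Submodule.span ℝ (Set.range fun i => vec M (F i))).restrictScalars _ :=
    Submodule.span_le.2 Submodule.subset_span
  exact this hx

/-- A wedge of vectors from one cone expands into wedges of subchains, whose ranks
`map_ind_mem_span` then lowers. -/
lemma volumeMap_surjective [M.Finite] [M.Loopless] (q : ℕ) :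
    Function.Surjective (volumeMap M q q) := by
  suffices framingGroup M q ≤
      LinearMap.range ((framingGroup M q).subtype.comp (volumeMap M q q)) by
    rintro ⟨x, hx⟩
    obtain ⟨c, hc⟩ := this hx
    exact ⟨c, Subtype.ext hc⟩
  refine Submodule.span_le.2 ?_
  rintro x ⟨l, F, hF, w, hw, rfl⟩
  refine map_mem_of_forall_strictMono _ (fun i => vec M (F i)) _ (fun g hg => ?_)
    fun i => cone_le_span F (hw i)
  have hK : IsChainBelow M M.E (rk M M.E) (F ∘ g) :=
    ⟨fun _ => hF.isFlat _, hF.strictAnti.comp_strictMono hg, fun _ => hF.nonempty _,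
      fun _ => (hF.isFlat _).subset_ground.ssubset_of_ne (hF.ne_ground _),
      fun _ => rk_mono (hF.isFlat _).subset_ground⟩
  have h := map_ind_mem_span (wedge M q) hK
  rw [wedge_ind] at h
  refine Submodule.span_le.2 ?_ h
  rintro _ ⟨L, hL, rfl⟩
  let L' : Chain M q q := ⟨L, isFlatChain_and_iff.2 (mem_chainsBelow.1 hL)⟩
  refine ⟨Finsupp.single L' 1, ?_⟩
  refine Eq.trans ?_ (wedge_ind L).symm
  rw [LinearMap.comp_apply, volumeMap, Finsupp.linearCombination_single, one_smul]
  rfl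

end MatroidFan

end

theorem theorem4p1 {α : Type*} (M : Matroid α) [M.Finite] [M.Loopless] (n p : ℕ)
    (hM : M.eRank = n + 1) (hp : p ≤ n) :
    -- exactness at the first term, whose outgoing map is the volume map if `p = 0`
    (p = 0 → Function.Injective (MatroidFan.volumeMap M p p)) ∧
    (0 < p → Function.Injective (MatroidFan.coboundary M p 0)) ∧
    -- exactness at the terms with chains of length `l + 1 < p`
    (∀ l : ℕ, l + 1 < p →
      Function.Exact (MatroidFan.coboundary M p l) (MatroidFan.coboundary M p (l + 1))) ∧
    -- exactness at the term with chains of length `l + 1 = p`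
    (∀ l : ℕ, l + 1 = p →
      Function.Exact (MatroidFan.coboundary M p l) (MatroidFan.volumeMap M p (l + 1))) ∧
    -- exactness at the framing group
    Function.Surjective (MatroidFan.volumeMap M p p) := by
  open MatroidFan in
  have hr : p < rk M M.E := by
    rw [← M.eRk_ground, ← coe_rk] at hM
    have : rk M M.E = n + 1 := by exact_mod_cast hM
    omega
  obtain ⟨hδ, hV⟩ := isCob_of_cocycle p M.ground_isFlat hr
  refine ⟨?_, fun h0 => ?_, fun l hl c => ⟨fun hc => ?_, ?_⟩, ?_, volumeMap_surjective p⟩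
  · rintro rfl
    rw [injective_iff_map_eq_zero]
    exact fun c hc => eq_zero_of_isCob_toCochain (hV _ (sum_vol_eq_zero_of_volumeMap_eq_zero hc))
  · rw [injective_iff_map_eq_zero]
    exact fun c hc => eq_zero_of_isCob_toCochain (hδ _ h0 (delta_toCochain_eq_zero hc))
  · exact isCob_toCochain_iff.1 (hδ _ hl (delta_toCochain_eq_zero hc))
  · rintro ⟨b, rfl⟩
    exact coboundary_coboundary b
  · rintro l rfl c
    refine ⟨fun hc => isCob_toCochain_iff.1 (hV _ (sum_vol_eq_zero_of_volumeMap_eq_zero hc)), ?_⟩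
    rintro ⟨b, rfl⟩
    exact volumeMap_coboundary hr b
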